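/- Let $s\ge 0$ be an integer and let $B:\mathbb R^{s}\times\mathbb R\to\mathbb R^{s}$ be a continuous map such that $x\mapsto B(x,0)$ is a $\mathcal C^1$ diffeomorphism at $0$, i.e. it restricts to a $\mathcal C^1$ diffeomorphism from some open neighbourhood of $0$ in $\mathbb R^s$ onto an open subset of $\mathbb R^s$. Let $F:\mathbb R^{s}\times\mathbb R\to\mathbb R^{s}$ be defined by $F(x,\theta)=\theta\,B(x,\theta)$. Then the image $F(\mathbb R^s\times\mathbb R)$ contains a nonempty open subset of $\mathbb R^{s}$. -/

import Mathlib

open scoped Manifold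

/-!
Reparametrising `x` by a local inverse `φ` of `B (·, 0)`, the maps `y ↦ B (φ y, θ)` converge,
uniformly on a closed ball around `B (0, 0)`, to the identity as `θ → 0`. Fix a small `θ ≠ 0`. A
continuous map uniformly close to the identity on a ball covers a smaller concentric ball
(`ball_subset_image_closedBall_of_norm_sub_lt`), so `θ • B (·, θ)` covers the dilate by `θ` of a
ball, which is open.

As `B` is only continuous in `θ`, the covering statement has the strength of Brouwer's theorem. It
is reduced by smooth approximation to the nonexistence of regular retractions of a ball onto its
sphere (`not_lipschitz_retraction_closedBall_sphere`). The latter follows the volume argument of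
Milnor and Rogers: the integral of the Jacobian of `id + t • (r - id)` over the ball is a polynomial
in `t` that equals the volume of the ball for small `t > 0` and vanishes at `t = 1`.
-/

section

open MeasureTheory Metric Set Polynomial

/-! ### Determinants and Lipschitz perturbations of the identity -/

theorem ContinuousLinearMap.exists_polynomial_eval_eq_det_id_add_smul
    {E : Type*} [NormedAddCommGroup E] [NormedSpace ℝ E] [FiniteDimensional ℝ E] (A : E →L[ℝ] E) :
    ∃ q : ℝ[X], q.natDegree ≤ Module.finrank ℝ E ∧
      ∀ t : ℝ, q.eval t = (ContinuousLinearMap.id ℝ E + t • A).det := by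
  let b := Module.finBasis ℝ E
  let M := LinearMap.toMatrix b b (A : E →ₗ[ℝ] E)
  refine ⟨Matrix.det ((X : ℝ[X]) • M.map C + (1 : Matrix _ _ ℝ).map C), ?_, fun t => ?_⟩
  · simpa using natDegree_det_X_add_C_le M 1
  · rw [ContinuousLinearMap.det, ← LinearMap.det_toMatrix b, ← coe_evalRingHom, RingHom.map_det]
    congr 1
    ext i j
    simp [M, LinearMap.toMatrix_apply, Matrix.one_apply, Finsupp.single_apply, eq_comm]
    split_ifs <;> simp <;> ring

theorem ContinuousLinearMap.det_id_add_pos_of_norm_lt_one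
    {E : Type*} [NormedAddCommGroup E] [NormedSpace ℝ E] [FiniteDimensional ℝ E] {A : E →L[ℝ] E}
    (hA : ‖A‖ < 1) : 0 < (ContinuousLinearMap.id ℝ E + A).det := by
  obtain ⟨q, -, hq⟩ := A.exists_polynomial_eval_eq_det_id_add_smul
  -- The determinant does not vanish along the segment from `id` to `id + A`, as a vector killed by
  -- `id + t • A` would satisfy `‖v‖ ≤ ‖A‖ * ‖v‖`.
  have hne : ∀ t ∈ Icc (0 : ℝ) 1, q.eval t ≠ 0 := by
    intro t ht h0
    rw [hq] at h0
    obtain ⟨v, hv, hv0⟩ := (Submodule.ne_bot_iff _).1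
      (LinearMap.bot_lt_ker_of_det_eq_zero h0).ne'
    have h1 : v = -(t • A v) := eq_neg_of_add_eq_zero_left (by simpa using hv)
    have h2 : ‖v‖ ≤ ‖A‖ * ‖v‖ := by
      calc ‖v‖ = t * ‖A v‖ := by
            conv_lhs => rw [h1]
            rw [norm_neg, norm_smul, Real.norm_of_nonneg ht.1]
        _ ≤ 1 * ‖A v‖ := by gcongr; exact ht.2
        _ ≤ ‖A‖ * ‖v‖ := by rw [one_mul]; exact A.le_opNorm v
    nlinarith [norm_pos_iff.2 hv0]
  by_contra! hle
  have h1 : q.eval 1 = (ContinuousLinearMap.id ℝ E + A).det := by simp [hq]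
  have h0 : q.eval 0 = 1 := by simp [hq, ContinuousLinearMap.det]
  obtain ⟨t, ht, ht0⟩ := intermediate_value_Icc' zero_le_one q.continuous.continuousOn
    (show (0 : ℝ) ∈ Icc (q.eval 1) (q.eval 0) from ⟨h1 ▸ hle, h0 ▸ zero_le_one⟩)
  exact hne t ht ht0

/-- If the integral of a family of polynomials of bounded degree, evaluated at `t`, does not depend
on `t ∈ (0, c)`, then it has the same value at every real number. Lagrange interpolation at nodes
in `(0, c)` gives this without any measurability of the coefficients. -/
theorem integral_polynomial_eval_eq_of_forall_mem_Ioo {α : Type*} [MeasurableSpace α]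
    {μ : Measure α} {q : α → ℝ[X]} {n : ℕ} (hq : ∀ x, (q x).natDegree ≤ n) {c V : ℝ} (hc : 0 < c)
    (hint : ∀ t ∈ Ioo 0 c, Integrable (fun x => (q x).eval t) μ)
    (hV : ∀ t ∈ Ioo 0 c, ∫ x, (q x).eval t ∂μ = V) (u : ℝ) :
    ∫ x, (q x).eval u ∂μ = V := by
  let v : ℕ → ℝ := fun i => c / (i + 2)
  have hv : ∀ i, v i ∈ Ioo 0 c := fun i =>
    ⟨by positivity, div_lt_self hc (by have : (0 : ℝ) ≤ i := i.cast_nonneg; linarith)⟩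
  have hinj : InjOn v (Finset.range (n + 1) : Set ℕ) := by
    intro i _ j _ hij
    have : c / ((i : ℝ) + 2) = c / ((j : ℝ) + 2) := hij
    rw [div_eq_div_iff (by positivity) (by positivity)] at this
    exact_mod_cast (add_right_cancel (mul_left_cancel₀ hc.ne' this)).symm
  let w : ℕ → ℝ := fun i => (Lagrange.basis (Finset.range (n + 1)) v i).eval u
  have hw : ∑ i ∈ Finset.range (n + 1), w i = 1 := by
    simpa [eval_finsetSum, w] using
      congrArg (eval u) (Lagrange.sum_basis hinj ⟨0, by simp⟩)
  have heval : ∀ x, (q x).eval u = ∑ i ∈ Finset.range (n + 1), (q x).eval (v i) * w i := by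
    intro x
    have hdeg : (q x).degree < (Finset.range (n + 1)).card := by
      rw [Finset.card_range]
      exact degree_le_natDegree.trans_lt (by exact_mod_cast Nat.lt_succ_of_le (hq x))
    conv_lhs => rw [Lagrange.eq_interpolate hinj hdeg, Lagrange.interpolate_apply]
    simp [eval_finsetSum, w]
  simp_rw [heval]
  rw [integral_finsetSum _ fun i _ => (hint _ (hv i)).mul_const _]
  simp_rw [integral_mul_const, hV _ (hv _), ← Finset.mul_sum, hw, mul_one]

/-- A Lipschitz function on a ball that vanishes on the sphere stays Lipschitz, with the same
constant, when extended by zero: a segment leaving the ball crosses the sphere. -/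
theorem LipschitzOnWith.lipschitzWith_indicator_closedBall
    {E F : Type*} [NormedAddCommGroup E] [NormedSpace ℝ E] [NormedAddCommGroup F]
    {h : E → F} {K : NNReal} {R : ℝ} (hh : LipschitzOnWith K h (closedBall 0 R))
    (h0 : ∀ x ∈ sphere (0 : E) R, h x = 0) :
    LipschitzWith K ((closedBall 0 R).indicator h) := by
  have key : ∀ x ∈ closedBall (0 : E) R, ∀ y ∉ closedBall (0 : E) R, ‖h x‖ ≤ K * dist x y := by
    intro x hx y hy
    rw [mem_closedBall_zero_iff] at hx hy
    obtain ⟨z, hz, hzR⟩ := (convex_segment x y).isPreconnected.intermediate_value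
      (left_mem_segment ℝ x y) (right_mem_segment ℝ x y) continuous_norm.continuousOn
      (show R ∈ Icc ‖x‖ ‖y‖ from ⟨hx, (not_le.1 hy).le⟩)
    have h1 := hh.dist_le_mul x (by simpa using hx) z (by simp [hzR])
    rw [h0 z (by simpa using hzR), dist_zero_right] at h1
    refine h1.trans ?_
    gcongr
    linarith [dist_add_dist_of_mem_segment hz, dist_nonneg (x := z) (y := y)]
  refine LipschitzWith.of_dist_le_mul fun x y => ?_
  by_cases hx : x ∈ closedBall (0 : E) R <;> by_cases hy : y ∈ closedBall (0 : E) R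
  · simpa only [indicator_of_mem, hx, hy] using hh.dist_le_mul x hx y hy
  · simpa only [indicator_of_mem, indicator_of_notMem, hx, hy, not_false_eq_true, dist_zero_right]
      using key x hx y hy
  · simpa only [indicator_of_mem, indicator_of_notMem, hx, hy, not_false_eq_true, dist_zero_left,
      dist_comm x y] using key y hy x hx
  · simp only [indicator_of_notMem, hx, hy, not_false_eq_true, dist_self]
    positivity

/-- A perturbation of the identity by a contraction is bijective. -/
theorem LipschitzWith.bijective_add_smul {E : Type*} [NormedAddCommGroup E] [NormedSpace ℝ E]
    [CompleteSpace E] {h : E → E} {K : NNReal} (hh : LipschitzWith K h) {t : ℝ} (ht : 0 ≤ t)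
    (htK : t * K < 1) : Function.Bijective fun x => x + t • h x := by
  lift t to NNReal using ht
  have happ : ApproximatesLinearOn (fun x => x + (t : ℝ) • h x)
      (ContinuousLinearEquiv.refl ℝ E : E →L[ℝ] E) univ (t * K) := by
    refine ApproximatesLinearOn.approximatesLinearOn_iff_lipschitzOnWith.2
      (LipschitzOnWith.of_dist_le_mul ?_)
    intro x _ y _
    have := mul_le_mul_of_nonneg_left (hh.dist_le_mul x y) t.2
    simpa [dist_smul₀, mul_assoc] using this
  have hN : Subsingleton E ∨
      t * K < ‖((ContinuousLinearEquiv.refl ℝ E).symm : E →L[ℝ] E)‖₊⁻¹ := by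
    rcases subsingleton_or_nontrivial E with hE | hE
    · exact .inl hE
    · right
      have : ‖((ContinuousLinearEquiv.refl ℝ E).symm : E →L[ℝ] E)‖₊ = 1 := by
        rw [← NNReal.coe_inj]
        simp
      rw [this, inv_one]
      exact_mod_cast htK
  exact ⟨injOn_univ.1 (happ.injOn hN), happ.surjective hN⟩

/-! ### The no-retraction theorem -/

/-- **No-retraction theorem**, in a regular form: no Lipschitz map that is differentiable inside the
ball retracts the closed ball onto its sphere.

Let `h = r - id`, extended by zero. For small `t > 0` the map `id + t • h` is a bijection of the
space fixing the complement of the ball, so it maps the ball onto itself and the integral of its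
Jacobian over the ball is the volume of the ball. That integral is a polynomial in `t`, so this
persists at `t = 1`, where the map is `r` and the Jacobian vanishes since `‖r‖` is constant. -/
theorem not_lipschitz_retraction_closedBall_sphere
    {E : Type*} [NormedAddCommGroup E] [InnerProductSpace ℝ E] [FiniteDimensional ℝ E]
    {r : E → E} {R : ℝ} {K : NNReal} (hR : 0 < R)
    (hlip : LipschitzOnWith K r (closedBall 0 R)) (hdiff : ∀ x ∈ ball 0 R, DifferentiableAt ℝ r x)
    (hnorm : ∀ x ∈ ball 0 R, ‖r x‖ = R) (hfix : ∀ x ∈ sphere 0 R, r x = x) : False := by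
  borelize E
  let μ : Measure E := Measure.addHaar
  let h : E → E := (closedBall 0 R).indicator fun x => r x - x
  let A : E → E →L[ℝ] E := fun x => fderiv ℝ r x - ContinuousLinearMap.id ℝ E
  have hL : LipschitzWith (K + 1) h :=
    (hlip.sub LipschitzWith.id.lipschitzOnWith).lipschitzWith_indicator_closedBall
      fun x hx => sub_eq_zero.2 (hfix x hx)
  have hout : ∀ x ∉ ball (0 : E) R, h x = 0 := by
    intro x hx
    by_cases hx' : x ∈ closedBall (0 : E) R
    · rw [show h x = r x - x from indicator_of_mem hx' _, sub_eq_zero]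
      refine hfix x ?_
      rw [mem_sphere_zero_iff_norm]
      rw [mem_ball_zero_iff, not_lt] at hx
      exact le_antisymm (mem_closedBall_zero_iff.1 hx') hx
    · exact indicator_of_notMem hx' _
  have hA : ∀ x ∈ ball (0 : E) R, HasFDerivAt h (A x) x := by
    intro x hx
    refine ((hdiff x hx).hasFDerivAt.sub (hasFDerivAt_id x)).congr_of_eventuallyEq ?_
    filter_upwards [isOpen_ball.mem_nhds hx] with y hy
    exact indicator_of_mem (ball_subset_closedBall hy) _
  choose q hqdeg hq using fun x => (A x).exists_polynomial_eval_eq_det_id_add_smul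
  let c : ℝ := ((K : ℝ) + 1)⁻¹
  have hc : 0 < c := by positivity
  -- For `t < c` the map `t • h` is a contraction, since `h` is `(K + 1)`-Lipschitz.
  have htK : ∀ t ∈ Ioo 0 c, t * ((K + 1 : NNReal) : ℝ) < 1 := by
    intro t ht
    have : t < ((K : ℝ) + 1)⁻¹ := ht.2
    push_cast
    calc t * (K + 1 : ℝ) < ((K : ℝ) + 1)⁻¹ * (K + 1) := by gcongr
      _ = 1 := inv_mul_cancel₀ (by positivity)
  have hbij := fun t (ht : t ∈ Ioo 0 c) => hL.bijective_add_smul ht.1.le (htK t ht)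
  have himage : ∀ t ∈ Ioo 0 c, (fun x => x + t • h x) '' ball 0 R = ball 0 R := by
    intro t ht
    have hid : ∀ x ∉ ball (0 : E) R, x + t • h x = x := fun x hx => by simp [hout x hx]
    ext y
    constructor
    · rintro ⟨x, hx, rfl⟩
      by_contra hy
      exact hy (((hbij t ht).1 (hid _ hy)).symm ▸ hx)
    · intro hy
      obtain ⟨x, rfl⟩ := (hbij t ht).2 y
      by_cases hx : x ∈ ball (0 : E) R
      · exact ⟨x, hx, rfl⟩
      · exact absurd (hid x hx ▸ hy) hx
  have hderiv : ∀ t : ℝ, ∀ x ∈ ball (0 : E) R, HasFDerivWithinAt (fun x => x + t • h x)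
      (ContinuousLinearMap.id ℝ E + t • A x) (ball 0 R) x := fun t x hx =>
    ((hasFDerivAt_id x).add ((hA x hx).const_smul t)).hasFDerivWithinAt
  have hpos : ∀ t ∈ Ioo 0 c, ∀ x ∈ ball (0 : E) R,
      |(ContinuousLinearMap.id ℝ E + t • A x).det| = (q x).eval t := by
    intro t ht x hx
    rw [hq, abs_of_pos]
    refine ContinuousLinearMap.det_id_add_pos_of_norm_lt_one ?_
    rw [norm_smul, Real.norm_of_nonneg ht.1.le]
    refine lt_of_le_of_lt ?_ (htK t ht)
    gcongr
    · exact ht.1.le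
    · rw [← (hA x hx).fderiv]
      exact norm_fderiv_le_of_lipschitz ℝ hL
  have hone := integral_polynomial_eval_eq_of_forall_mem_Ioo (μ := μ.restrict (ball 0 R))
    hqdeg hc (V := μ.real (ball 0 R))
    (fun t ht => by
      have := (integrableOn_image_iff_integrableOn_abs_det_fderiv_smul μ measurableSet_ball
        (hderiv t) (hbij t ht).1.injOn fun _ => (1 : ℝ)).1
        (by rw [himage t ht]; exact integrableOn_const measure_ball_lt_top.ne)
      refine IntegrableOn.congr_fun this (fun x hx => ?_) measurableSet_ball
      simp [hpos t ht x hx])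
    (fun t ht => by
      have := integral_image_eq_integral_abs_det_fderiv_smul μ measurableSet_ball
        (hderiv t) (hbij t ht).1.injOn fun _ => (1 : ℝ)
      rw [himage t ht] at this
      rw [setIntegral_congr_fun measurableSet_ball fun x hx => (hpos t ht x hx).symm]
      simpa using this.symm) 1
  have hzero : ∀ x ∈ ball (0 : E) R, (q x).eval 1 = 0 := by
    intro x hx
    -- Differentiating `‖r‖ ^ 2 = R ^ 2` shows that the range of the derivative is orthogonal to `r x`.
    have hDr : ∀ v, inner ℝ (r x) (fderiv ℝ r x v) = 0 := by
      intro v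
      have h1 := (hdiff x hx).hasFDerivAt.norm_sq
      have h2 : HasFDerivAt (fun y => ‖r y‖ ^ 2) (0 : E →L[ℝ] ℝ) x := by
        refine (hasFDerivAt_const (R ^ 2) x).congr_of_eventuallyEq ?_
        filter_upwards [isOpen_ball.mem_nhds hx] with y hy
        rw [hnorm y hy]
      simpa using congrArg (fun L : E →L[ℝ] ℝ => L v) (h1.unique h2)
    rw [hq, one_smul, add_sub_cancel]
    by_contra hdet
    obtain ⟨v, hv⟩ := ((fderiv ℝ r x).toContinuousLinearEquivOfDetNeZero hdet).surjective (r x)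
    have hv' : fderiv ℝ r x v = r x := hv
    have := hDr v
    rw [hv', real_inner_self_eq_norm_sq, hnorm x hx] at this
    exact hR.ne' (by simpa using this)
  rw [setIntegral_congr_fun measurableSet_ball hzero, integral_zero] at hone
  exact (ENNReal.toReal_pos (measure_ball_pos μ 0 hR).ne' measure_ball_lt_top.ne).ne hone

/-! ### Zeros and images of maps close to the identity -/

/-- A `C¹` map at distance less than `R` from the identity on the ball of radius `R` has a zero there.
Otherwise, moving `x` in the direction `f x` until it meets the sphere would define a retraction
excluded by `not_lipschitz_retraction_closedBall_sphere`. -/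
theorem exists_zero_of_contDiff_of_norm_sub_lt
    {E : Type*} [NormedAddCommGroup E] [InnerProductSpace ℝ E] [FiniteDimensional ℝ E]
    {f : E → E} (hf : ContDiff ℝ 1 f) {R : ℝ} (hR : 0 < R)
    (hfR : ∀ x ∈ closedBall 0 R, ‖f x - x‖ < R) : ∃ x ∈ closedBall 0 R, f x = 0 := by
  by_contra! hne
  -- `d x` is the reduced discriminant of the quadratic equation `‖x + l • f x‖ ^ 2 = R ^ 2` in `l`,
  -- and `l x` is its larger root, which is zero on the sphere because `inner ℝ x (f x) > 0` there.
  let d : E → ℝ := fun x => inner ℝ x (f x) ^ 2 + ‖f x‖ ^ 2 * (R ^ 2 - ‖x‖ ^ 2)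
  let l : E → ℝ := fun x => (√(d x) - inner ℝ x (f x)) / ‖f x‖ ^ 2
  let r : E → E := fun x => x + l x • f x
  have hinner : ∀ x ∈ sphere (0 : E) R, 0 < inner ℝ x (f x) := by
    intro x hx
    have h1 := hfR x (sphere_subset_closedBall hx)
    rw [mem_sphere_zero_iff_norm] at hx
    have h2 := norm_sub_sq_real (f x) x
    rw [hx, real_inner_comm] at h2
    have h3 : ‖f x - x‖ ^ 2 < R ^ 2 := by gcongr
    nlinarith [sq_nonneg ‖f x‖]
  have hdpos : ∀ x ∈ closedBall (0 : E) R, 0 < d x := by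
    intro x hx
    have hfx : 0 < ‖f x‖ := norm_pos_iff.2 (hne x hx)
    rcases (mem_closedBall_zero_iff.1 hx).lt_or_eq with hlt | heq
    · have : 0 < R ^ 2 - ‖x‖ ^ 2 := sub_pos.2 (by gcongr)
      positivity
    · have := hinner x (mem_sphere_zero_iff_norm.2 heq)
      simp only [d, heq, sub_self, mul_zero, add_zero]
      positivity
  have hr : ContDiffOn ℝ 1 r (closedBall 0 R) := by
    have hi : ContDiff ℝ 1 fun x => inner ℝ x (f x) := contDiff_id.inner ℝ hf
    have hd : ContDiff ℝ 1 d :=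
      (hi.pow 2).add ((hf.norm_sq ℝ).mul (contDiff_const.sub (contDiff_id.norm_sq ℝ)))
    refine contDiffOn_id.add (ContDiffOn.smul (ContDiffOn.div ?_ (hf.norm_sq ℝ).contDiffOn ?_)
      hf.contDiffOn)
    · exact (hd.contDiffOn.sqrt fun x hx => (hdpos x hx).ne').sub hi.contDiffOn
    · exact fun x hx => pow_ne_zero _ (norm_ne_zero_iff.2 (hne x hx))
  obtain ⟨K, hK⟩ := hr.exists_lipschitzOnWith one_ne_zero (convex_closedBall 0 R)
    (isCompact_closedBall 0 R)
  refine not_lipschitz_retraction_closedBall_sphere hR hK (fun x hx => ?_) (fun x hx => ?_)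
    fun x hx => ?_
  · exact (hr.contDiffAt (Filter.mem_of_superset (isOpen_ball.mem_nhds hx)
      ball_subset_closedBall)).differentiableAt one_ne_zero
  · have hx' := ball_subset_closedBall hx
    have hfx : ‖f x‖ ^ 2 ≠ 0 := pow_ne_zero _ (norm_ne_zero_iff.2 (hne x hx'))
    rw [← sq_eq_sq₀ (norm_nonneg _) hR.le, norm_add_sq_real, inner_smul_right, norm_smul, mul_pow,
      Real.norm_eq_abs, sq_abs]
    have hl : l x * ‖f x‖ ^ 2 = √(d x) - inner ℝ x (f x) := div_mul_cancel₀ _ hfx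
    have hs : √(d x) ^ 2 = inner ℝ x (f x) ^ 2 + ‖f x‖ ^ 2 * (R ^ 2 - ‖x‖ ^ 2) :=
      Real.sq_sqrt (hdpos x hx').le
    refine mul_left_cancel₀ hfx ?_
    have hs' : √(d x) = l x * ‖f x‖ ^ 2 + inner ℝ x (f x) := by rw [hl]; ring
    rw [hs'] at hs
    linear_combination hs
  · have hx1 := mem_sphere_zero_iff_norm.1 hx
    have : l x = 0 := by simp [l, d, hx1, Real.sqrt_sq (hinner x hx).le]
    simp [r, this]

/-- A continuous map at distance less than `R` from the identity on the ball of radius `R` has a zero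
there. This is a form of Brouwer's fixed point theorem. -/
theorem exists_zero_of_continuous_of_norm_sub_lt
    {E : Type*} [NormedAddCommGroup E] [InnerProductSpace ℝ E] [FiniteDimensional ℝ E]
    {f : E → E} (hf : Continuous f) {R : ℝ} (hR : 0 < R)
    (hfR : ∀ x ∈ closedBall 0 R, ‖f x - x‖ < R) : ∃ x ∈ closedBall 0 R, f x = 0 := by
  by_contra! hne
  have hK : IsCompact (closedBall (0 : E) R) := isCompact_closedBall 0 R
  -- A smooth approximation closer than this minimum still has no zero and still satisfies the bound.
  have hpos : ∀ x ∈ closedBall (0 : E) R, 0 < min ‖f x‖ (R - ‖f x - x‖) := fun x hx =>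
    lt_min (norm_pos_iff.2 (hne x hx)) (sub_pos.2 (hfR x hx))
  obtain ⟨z, hz, hzmin⟩ := hK.exists_isMinOn ⟨0, by simp [hR.le]⟩
    (f := fun x => min ‖f x‖ (R - ‖f x - x‖)) (by fun_prop)
  obtain ⟨g, hg, hgf, -⟩ := hf.exists_contDiff_approx 1 continuous_const fun _ => hpos z hz
  obtain ⟨x, hx, hgx⟩ := exists_zero_of_contDiff_of_norm_sub_lt hg hR fun x hx => by
    have h1 := (hgf x).trans_le ((hzmin hx).trans (min_le_right _ _))
    rw [dist_eq_norm] at h1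
    have h2 := norm_add_le (g x - f x) (f x - x)
    rw [sub_add_sub_cancel] at h2
    linarith
  have h1 := (hgf x).trans_le ((hzmin hx).trans (min_le_left _ _))
  rw [hgx, dist_zero_left] at h1
  exact h1.false

theorem ball_subset_image_closedBall_of_norm_sub_lt
    {E : Type*} [NormedAddCommGroup E] [InnerProductSpace ℝ E] [FiniteDimensional ℝ E]
    {f : E → E} (hf : Continuous f) {b : E} {R ε : ℝ} (hR : 0 < R)
    (hfε : ∀ x ∈ closedBall b R, ‖f x - x‖ < ε) :
    ball b (R - ε) ⊆ f '' closedBall b R := by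
  intro y hy
  have hy' : ‖b - y‖ < R - ε := by rwa [mem_ball, dist_comm, dist_eq_norm] at hy
  obtain ⟨z, hz, hfz⟩ := exists_zero_of_continuous_of_norm_sub_lt
    (f := fun z => f (b + z) - y) (by fun_prop) hR fun z hz => by
      have h1 := hfε (b + z) (by simpa using hz)
      have h2 := norm_add_le (f (b + z) - (b + z)) (b - y)
      rw [show f (b + z) - (b + z) + (b - y) = f (b + z) - y - z by abel] at h2
      linarith
  exact ⟨b + z, by simpa using hz, sub_eq_zero.1 hfz⟩

end

/-! ### Images of scaled families of local diffeomorphisms -/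

theorem mainTheorem6 (s : ℕ)
    (B F : EuclideanSpace ℝ (Fin s) × ℝ → EuclideanSpace ℝ (Fin s))
    (hB : Continuous B)
    (hB0 : IsLocalDiffeomorphAt 𝓘(ℝ, EuclideanSpace ℝ (Fin s)) 𝓘(ℝ, EuclideanSpace ℝ (Fin s)) 1
      (fun x : EuclideanSpace ℝ (Fin s) => B (x, 0)) 0)
    (hF : ∀ (x : EuclideanSpace ℝ (Fin s)) (θ : ℝ), F (x, θ) = θ • B (x, θ)) :
    ∃ U : Set (EuclideanSpace ℝ (Fin s)), IsOpen U ∧ U.Nonempty ∧ U ⊆ Set.range F := by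
  obtain ⟨Φ, h0, hΦ⟩ := hB0
  let b := Φ 0
  obtain ⟨R, hR, hRΦ⟩ := Metric.nhds_basis_closedBall.mem_iff.1
    (Φ.open_target.mem_nhds (Φ.map_source h0))
  have hinv : ContinuousOn Φ.invFun (Metric.closedBall b R) :=
    Φ.contMDiffOn_invFun.continuousOn.mono hRΦ
  -- Extending the local inverse by Tietze makes `y ↦ B (φ y, θ)` continuous on the whole
  -- space; at `θ = 0` it is the identity on the ball.
  obtain ⟨φ, hφ⟩ := ContinuousMap.exists_restrict_eq Metric.isClosed_closedBall
    ⟨(Metric.closedBall b R).domRestrict Φ.invFun, hinv.domRestrict⟩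
  have hBφ : ∀ y ∈ Metric.closedBall b R, B (φ y, 0) = y := by
    intro y hy
    have h1 : φ y = Φ.invFun y := congrArg (fun k => k ⟨y, hy⟩) hφ
    rw [h1]
    exact (hΦ (Φ.map_target (hRΦ hy))).trans (Φ.right_inv (hRΦ hy))
  have hnear : ∀ᶠ θ in nhds (0 : ℝ), ∀ y ∈ Metric.closedBall b R, ‖B (φ y, θ) - y‖ < R / 2 := by
    refine (isCompact_closedBall b R).eventually_forall_of_forall_eventually fun y hy => ?_
    have hcont : Continuous fun z : ℝ × EuclideanSpace ℝ (Fin s) => ‖B (φ z.2, z.1) - z.2‖ := by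
      fun_prop
    refine hcont.continuousAt.eventually_lt continuousAt_const ?_
    simpa [hBφ y hy] using hR
  obtain ⟨θ, hθ, hθ0⟩ := ((hnear.filter_mono nhdsWithin_le_nhds).and
    (self_mem_nhdsWithin (s := {(0 : ℝ)}ᶜ))).exists
  refine ⟨(fun y => θ • y) '' Metric.ball b (R - R / 2), (isOpenMap_smul₀ hθ0) _ Metric.isOpen_ball,
    (Metric.nonempty_ball.2 (by linarith)).image _, ?_⟩
  rintro _ ⟨y, hy, rfl⟩
  obtain ⟨x, -, rfl⟩ := ball_subset_image_closedBall_of_norm_sub_lt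
    (f := fun y => B (φ y, θ)) (by fun_prop) hR hθ hy
  exact ⟨(φ x, θ), hF _ _⟩
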